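/- All rings are associative with $1$, but not necessarily commutative. A ring $S$ is called weakly nil-clean if every $a\in S$ can be written as $a=b+e$ or $a=b-e$ with $b\in S$ nilpotent and $e\in S$ idempotent. A ring $R$ is called strongly regular if it is an abelian von Neumann regular ring, that is, all idempotents of $R$ are central and every $a\in R$ satisfies $a=axa$ for some $x\in R$. A ring is called Boolean if all its elements are idempotent. Let $R$ be a strongly regular ring and let $n\geq 2$ be an integer. Then the ring $\mathbb{M}_n(R)$ of all $n\times n$ matrices over $R$ is weakly nil-clean if and only if $R$ is Boolean. -/

import Mathlib

/-- An element of a ring is weakly nil-clean if it is the sum or the difference of a nilpotent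
and an idempotent. -/
def IsWeaklyNilCleanElem {R : Type*} [Ring R] (a : R) : Prop :=
  ∃ b e : R, IsNilpotent b ∧ IsIdempotentElem e ∧ (a = b + e ∨ a = b - e)

/-- A (not necessarily commutative) ring is weakly nil-clean if all its elements are. -/
def IsWeaklyNilCleanRing (R : Type*) [Ring R] : Prop :=
  ∀ a : R, IsWeaklyNilCleanElem a

/-- A ring is abelian if all its idempotents are central. -/
def IsAbelianRing (R : Type*) [Ring R] : Prop :=
  ∀ e : R, IsIdempotentElem e → e ∈ Subring.center R

/-- A ring is (von Neumann) regular if every element `a` has the form `a * x * a`. -/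
def IsVonNeumannRegularRing (R : Type*) [Ring R] : Prop :=
  ∀ a : R, ∃ x : R, a = a * x * a

/-- A ring is strongly regular if it is an abelian (von Neumann) regular ring. -/
def IsStronglyRegularRing (R : Type*) [Ring R] : Prop :=
  IsAbelianRing R ∧ IsVonNeumannRegularRing R

/-- A ring is Boolean if all its elements are idempotent. -/
def IsBooleanRing (R : Type*) [Ring R] : Prop :=
  ∀ a : R, IsIdempotentElem a

/-! If `R` is Boolean, every matrix is even nil-clean. Over F_2, split off the cyclic subspace of a
nonzero vector and induct on dimension: nil-cleanness lifts from an invariant subspace and its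
quotient (`IsNilCleanElem.of_restrict_of_mapQ`), and companion blocks decompose explicitly,
according to their trace. A matrix over `R` is the image of a generic matrix over a finite power of
F_2 (`exists_ringHom_of_boolean`), where one decomposes coordinatewise.

Conversely, if a² ≠ a, some division ring quotient D of `R` keeps a² - a nonzero, and M_n(D) is
again weakly nil-clean. Testing it on the matrices b·e_ii forces D = {0, 1, -1}, and diag(1, -1, 0,
…) excludes F_3. So D is F_2, where a² = a. -/

/-- An element is nil-clean if it differs from some idempotent by a nilpotent. -/
def IsNilCleanElem {R : Type*} [Ring R] (a : R) : Prop :=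
  ∃ e : R, IsIdempotentElem e ∧ IsNilpotent (a - e)

theorem IsNilCleanElem.isWeaklyNilCleanElem {R : Type*} [Ring R] {a : R}
    (h : IsNilCleanElem a) : IsWeaklyNilCleanElem a := by
  obtain ⟨e, he, hn⟩ := h
  exact ⟨a - e, e, hn, he, Or.inl (by abel)⟩

theorem IsNilCleanElem.map {R S : Type*} [Ring R] [Ring S] (f : R →+* S) {a : R}
    (h : IsNilCleanElem a) : IsNilCleanElem (f a) := by
  obtain ⟨e, he, hn⟩ := h
  exact ⟨f e, he.map f, by simpa using hn.map f⟩

/-! ### Extensions of nil-clean endomorphisms -/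

section Glue
variable {K V : Type*} [Field K] [AddCommGroup V] [Module K V]

/-- Along a complement of `W`, the block diagonal idempotent with blocks `e₁`, `e₂` leaves a block
triangular difference with nilpotent diagonal blocks. -/
theorem IsNilCleanElem.of_restrict_of_mapQ (T : Module.End K V) (W : Submodule K V)
    (hW : ∀ w ∈ W, T w ∈ W) (h₁ : IsNilCleanElem (R := Module.End K W) (T.restrict hW))
    (h₂ : IsNilCleanElem (R := Module.End K (V ⧸ W)) (W.mapQ W T hW)) : IsNilCleanElem T := by
  obtain ⟨e₁, he₁, k, hk⟩ := h₁
  obtain ⟨e₂, he₂, l, hl⟩ := h₂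
  obtain ⟨p, hp⟩ := W.subtype.exists_leftInverse_of_injective (by simp)
  obtain ⟨s₀, hs₀⟩ := W.mkQ.exists_rightInverse_of_surjective (by simp)
  have hp' : ∀ w : W, p w = w := fun w => LinearMap.congr_fun hp w
  have hs₀' : ∀ x, W.mkQ (s₀ x) = x := fun x => LinearMap.congr_fun hs₀ x
  have hq : ∀ w : W, W.mkQ (w : V) = 0 := by simp
  -- The correction puts the image of the section inside the kernel of `p`, as idempotency of `E`
  -- requires.
  let s : V ⧸ W →ₗ[K] V := s₀ - W.subtype ∘ₗ p ∘ₗ s₀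
  have hs : ∀ x, W.mkQ (s x) = x := fun x => by
    simp only [s, LinearMap.sub_apply, map_sub, hs₀', LinearMap.comp_apply, Submodule.subtype_apply,
      hq, sub_zero]
  have hps : ∀ x, p (s x) = 0 := fun x => by
    simp only [s, LinearMap.sub_apply, map_sub, LinearMap.comp_apply, Submodule.subtype_apply,
      hp', sub_self]
  have hee₁ : ∀ x, e₁ (e₁ x) = e₁ x := fun x => LinearMap.congr_fun he₁ x
  have hee₂ : ∀ x, e₂ (e₂ x) = e₂ x := fun x => LinearMap.congr_fun he₂ x
  let E : Module.End K V := W.subtype ∘ₗ e₁ ∘ₗ p + s ∘ₗ e₂ ∘ₗ W.mkQ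
  have hE : ∀ x, E x = (e₁ (p x) : V) + s (e₂ (W.mkQ x)) := fun x => rfl
  refine ⟨E, ?_, k + l, ?_⟩
  · refine LinearMap.ext fun x => ?_
    rw [Module.End.mul_apply, hE x, map_add, hE, hE, hp', hq, hps, hs, hee₁, hee₂]
    simp
  · have hN₁ : ∀ (j : ℕ) (w : W), ((T - E) ^ j) (w : V) =
        (((T.restrict hW : Module.End K W) - e₁) ^ j) w := by
      intro j
      induction j with
      | zero => simp
      | succ j ih =>
        intro w
        have : (T - E) (w : V) = (((T.restrict hW : Module.End K W) - e₁) w : W) := by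
          rw [LinearMap.sub_apply, hE, hp', hq]
          simp
        rw [pow_succ, Module.End.mul_apply, this, ih, pow_succ, Module.End.mul_apply]
    have hN₂ : ∀ (j : ℕ) (x : V), W.mkQ (((T - E) ^ j) x) =
        (((W.mapQ W T hW : Module.End K (V ⧸ W)) - e₂) ^ j) (W.mkQ x) := by
      intro j
      induction j with
      | zero => simp
      | succ j ih =>
        intro x
        have : W.mkQ ((T - E) x) = ((W.mapQ W T hW : Module.End K (V ⧸ W)) - e₂) (W.mkQ x) := by
          rw [LinearMap.sub_apply, map_sub, hE, map_add, hq, hs, LinearMap.sub_apply, zero_add]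
          simp
        rw [pow_succ, Module.End.mul_apply, ih, this, pow_succ, Module.End.mul_apply]
    refine LinearMap.ext fun x => ?_
    have hx := hN₂ l x
    rw [hl, LinearMap.zero_apply, Submodule.mkQ_apply, Submodule.Quotient.mk_eq_zero] at hx
    have := hN₁ k ⟨_, hx⟩
    rw [pow_add, Module.End.mul_apply]
    simpa [hk] using this
end Glue

/-! ### Companion blocks -/

section Cyclic
variable {K V : Type*} [Field K] [AddCommGroup V] [Module K V]

/-- Let `E` be the last column of the companion matrix: it is idempotent since its diagonal entry is
1, and what remains is the nilpotent shift. -/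
theorem isNilCleanElem_of_cyclic_of_eq_one {m : ℕ} (T : Module.End K V) (v : V)
    (t : Module.Basis (Fin (m + 1)) K V) (ht : ∀ i, t i = (T ^ (i : ℕ)) v)
    (hc : t.repr ((T ^ (m + 1)) v) (Fin.last m) = 1) : IsNilCleanElem T := by
  let E : Module.End K V := t.constr K fun i => if i = Fin.last m then (T ^ (m + 1)) v else 0
  have hE : ∀ i, E (t i) = if i = Fin.last m then (T ^ (m + 1)) v else 0 :=
    fun i => t.constr_basis K _ i
  have hElast : E (t (Fin.last m)) = (T ^ (m + 1)) v := by simp [hE]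
  have hEcast : ∀ i : Fin m, E (t i.castSucc) = 0 := fun i => by
    rw [hE, if_neg (Fin.castSucc_lt_last i).ne]
  have hstep : ∀ j : ℕ, (T ^ (j + 1)) v = T ((T ^ j) v) := fun j => by
    rw [pow_succ', Module.End.mul_apply]
  have hEv : ∀ j < m, E ((T ^ j) v) = 0 := fun j hj => by
    simpa [ht] using hEcast ⟨j, hj⟩
  have hEm : E ((T ^ m) v) = (T ^ (m + 1)) v := by simpa [ht] using hElast
  have hEE : E ((T ^ (m + 1)) v) = (T ^ (m + 1)) v := by
    conv_lhs => rw [← t.sum_repr ((T ^ (m + 1)) v)]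
    rw [map_sum, Fin.sum_univ_castSucc]
    simp [hEcast, hElast, hc]
  refine ⟨E, t.ext fun i => ?_, m + 1, ?_⟩
  · induction i using Fin.lastCases with
    | last => rw [Module.End.mul_apply, hElast, hEE]
    | cast i => rw [Module.End.mul_apply, hEcast, map_zero]
  · have hpow : ∀ j ≤ m, ((T - E) ^ j) v = (T ^ j) v := by
      intro j
      induction j with
      | zero => simp
      | succ j ih =>
        intro hj
        rw [pow_succ', Module.End.mul_apply, ih (by lia), LinearMap.sub_apply, hEv j (by lia),
          hstep, sub_zero]
    have hzero : ((T - E) ^ (m + 1)) v = 0 := by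
      rw [pow_succ', Module.End.mul_apply, hpow m le_rfl, LinearMap.sub_apply, hEm, hstep, sub_self]
    refine t.ext fun i => ?_
    rw [ht, ← hpow i (by lia), ← Module.End.mul_apply, ← pow_add, add_comm, pow_add,
      Module.End.mul_apply, hzero, map_zero, LinearMap.zero_apply]

/-- Trace 2 calls for an idempotent of rank two, supported on the last two columns. -/
theorem isNilCleanElem_of_cyclic_of_eq_two {m : ℕ} (T : Module.End K V) (v : V)
    (t : Module.Basis (Fin (m + 3)) K V) (ht : ∀ i, t i = (T ^ (i : ℕ)) v)
    (hc : t.repr ((T ^ (m + 3)) v) (Fin.last (m + 2)) = 2) : IsNilCleanElem T := by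
  set c := t.repr ((T ^ (m + 3)) v) (Fin.last (m + 1)).castSucc with hcdef
  -- This `β` cancels the `x₁` term of `E x₂`, giving `h₂'`. The value of `E` at `x₂` is the one for
  -- which `T - E` kills `x₂ - x₁ + β • x₀`, the last vector of its chain from `v`.
  let β : K := -(c + 1)
  let x₀ := (T ^ m) v
  let x₁ := (T ^ (m + 1)) v
  let x₂ := (T ^ (m + 2)) v
  let x₃ := (T ^ (m + 3)) v
  let g : Fin (m + 3) → V := fun i => if (i : ℕ) = m + 2 then x₃ - x₂ + x₁ - β • x₀ + β • x₁
    else if (i : ℕ) = m + 1 then x₁ - β • x₀ else 0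
  let E : Module.End K V := t.constr K g
  have hE : ∀ i, E (t i) = g i := fun i => t.constr_basis K _ i
  have hEv : ∀ j (hj : j < m + 3), E ((T ^ j) v) = g ⟨j, hj⟩ := fun j hj => by
    rw [← hE, ht]
  have hlow : ∀ j ≤ m, E ((T ^ j) v) = 0 := fun j hj => by
    rw [hEv j (by lia)]
    simp only [g]
    rw [if_neg (by lia), if_neg (by lia)]
  have h₀ : E x₀ = 0 := hlow m le_rfl
  have h₁ : E x₁ = x₁ - β • x₀ := by
    simp only [x₁]
    rw [hEv (m + 1) (by lia)]
    simp [g, x₁]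
  have h₂ : E x₂ = x₃ - x₂ + x₁ - β • x₀ + β • x₁ := by
    simp only [x₂]
    rw [hEv (m + 2) (by lia)]
    simp [g, x₂]
  obtain ⟨u, hu, hx₃⟩ : ∃ u, E u = 0 ∧ x₃ = u + c • x₁ + (2 : K) • x₂ := by
    refine ⟨∑ i : Fin (m + 1), t.repr x₃ i.castSucc.castSucc • t i.castSucc.castSucc, ?_, ?_⟩
    · rw [map_sum]
      refine Finset.sum_eq_zero fun i _ => ?_
      rw [map_smul, ht, hlow _ (by simpa using Nat.lt_succ_iff.mp i.2), smul_zero]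
    · conv_lhs => rw [← t.sum_repr x₃, Fin.sum_univ_castSucc, Fin.sum_univ_castSucc]
      simp only [x₃, hc, ← hcdef]
      simp [ht, x₁, x₂]
  have h₂' : E x₂ = x₂ + (u - β • x₀) := by
    rw [h₂, hx₃]
    simp only [β]
    module
  have hstep : ∀ j : ℕ, (T ^ (j + 1)) v = T ((T ^ j) v) := fun j => by
    rw [pow_succ', Module.End.mul_apply]
  have hT₀ : T x₀ = x₁ := (hstep _).symm
  have hT₁ : T x₁ = x₂ := (hstep _).symm
  have hT₂ : T x₂ = x₃ := (hstep _).symm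
  refine ⟨E, t.ext fun i => ?_, m + 3, ?_⟩
  · rw [Module.End.mul_apply, ht]
    rcases (by lia : (i : ℕ) ≤ m ∨ (i : ℕ) = m + 1 ∨ (i : ℕ) = m + 2) with h | h | h
    · rw [hlow _ h, map_zero]
    · rw [h]
      change E (E x₁) = E x₁
      conv_lhs => rw [h₁, map_sub, map_smul, h₀, smul_zero, sub_zero]
    · rw [h]
      change E (E x₂) = E x₂
      conv_lhs => rw [h₂', map_add, map_sub, map_smul, h₀, hu, smul_zero, sub_zero, add_zero]
  · let N := T - E
    have hN : ∀ x, N x = T x - E x := fun x => rfl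
    have hpow : ∀ j ≤ m + 1, (N ^ j) v = (T ^ j) v := by
      intro j
      induction j with
      | zero => simp
      | succ j ih =>
        intro hj
        rw [pow_succ', Module.End.mul_apply, ih (by lia), hN, hlow j (by lia),
          hstep, sub_zero]
    have hf : (N ^ (m + 2)) v = x₂ - x₁ + β • x₀ := by
      rw [pow_succ', Module.End.mul_apply, hpow _ le_rfl, hN]
      change T x₁ - E x₁ = _
      rw [hT₁, h₁]
      abel
    have hzero : (N ^ (m + 3)) v = 0 := by
      rw [pow_succ', Module.End.mul_apply, hf, hN]
      simp only [map_add, map_sub, map_smul, hT₀, hT₁, hT₂, h₀, h₁, h₂]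
      module
    have hkill : ∀ j, (N ^ (m + 3)) ((N ^ j) v) = 0 := fun j => by
      rw [← Module.End.mul_apply, ← pow_add, add_comm, pow_add, Module.End.mul_apply, hzero,
        map_zero]
    have hk : ∀ j ≤ m + 1, (N ^ (m + 3)) ((T ^ j) v) = 0 := fun j hj => by
      rw [← hpow j hj, hkill]
    refine t.ext fun i => ?_
    rw [ht, LinearMap.zero_apply]
    rcases (by lia : (i : ℕ) ≤ m + 1 ∨ (i : ℕ) = m + 2) with h | h
    · exact hk _ h
    · rw [h]
      have h3 := hkill (m + 2)
      have hk₁ : (N ^ (m + 3)) x₁ = 0 := hk _ le_rfl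
      have hk₀ : (N ^ (m + 3)) x₀ = 0 := hk _ (by lia)
      rw [hf, map_add, map_sub, map_smul, hk₁, hk₀, smul_zero, sub_zero, add_zero] at h3
      exact h3
end Cyclic

theorem ZMod.two_eq_zero_or_eq_one (c : ZMod 2) : c = 0 ∨ c = 1 := by
  revert c; decide

theorem isNilCleanElem_of_cyclic {V : Type*} [AddCommGroup V] [Module (ZMod 2) V] {d : ℕ}
    (T : Module.End (ZMod 2) V) (v : V)
    (t : Module.Basis (Fin d) (ZMod 2) V) (ht : ∀ i, t i = (T ^ (i : ℕ)) v) :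
    IsNilCleanElem T := by
  match d, t, ht with
  | 0, t, ht => exact ⟨0, .zero, 1, t.ext fun i => i.elim0⟩
  | 1, t, ht =>
    rcases ZMod.two_eq_zero_or_eq_one (t.repr ((T ^ 1) v) (Fin.last 0)) with hc | hc
    · refine ⟨0, .zero, 1, t.ext fun i => ?_⟩
      have h := t.sum_repr ((T ^ 1) v)
      fin_cases i
      simp_all
    · exact isNilCleanElem_of_cyclic_of_eq_one T v t ht hc
  | 2, t, ht =>
    rcases ZMod.two_eq_zero_or_eq_one (t.repr ((T ^ 2) v) (Fin.last 1)) with hc | hc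
    · have h := t.sum_repr ((T ^ 2) v)
      have h0 : t 0 = v := by simp [ht]
      have h1 : t 1 = T v := by simp [ht]
      rw [Fin.sum_univ_two, show (1 : Fin 2) = Fin.last 1 from rfl, hc, zero_smul, add_zero, h0,
        pow_two, Module.End.mul_apply] at h
      rcases ZMod.two_eq_zero_or_eq_one (t.repr (T (T v)) 0) with hc' | hc'
      · rw [hc', zero_smul] at h
        refine ⟨0, .zero, 2, t.ext fun i => ?_⟩
        rw [sub_zero, pow_two, Module.End.mul_apply, LinearMap.zero_apply]
        fin_cases i
        · simp [h0, ← h]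
        · simp [h1, ← h]
      · rw [hc', one_smul] at h
        -- Here T² = 1, so (T - 1)² = 0 in characteristic 2.
        refine ⟨1, .one, 2, t.ext fun i => ?_⟩
        have hneg : ∀ x : V, -x = x := fun x => ZModModule.neg_eq_self x
        rw [pow_two, Module.End.mul_apply, LinearMap.zero_apply]
        fin_cases i
        · simp only [Fin.zero_eta, h0, LinearMap.sub_apply, map_sub, Module.End.one_apply, ← h]
          rw [← neg_sub (T v), hneg, sub_self]
        · simp only [Fin.mk_one, h1, LinearMap.sub_apply, map_sub, Module.End.one_apply, ← h]
          rw [← neg_sub (T v), hneg, sub_self]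
    · exact isNilCleanElem_of_cyclic_of_eq_one T v t ht hc
  | m + 3, t, ht =>
    rcases ZMod.two_eq_zero_or_eq_one (t.repr ((T ^ (m + 3)) v) (Fin.last (m + 2))) with hc | hc
    · exact isNilCleanElem_of_cyclic_of_eq_two T v t ht (hc.trans (by decide))
    · exact isNilCleanElem_of_cyclic_of_eq_one T v t ht hc

theorem exists_cyclic_submodule {K V : Type*} [Field K] [AddCommGroup V] [Module K V]
    [FiniteDimensional K V] (T : Module.End K V) (v : V) :
    ∃ d : ℕ, LinearIndependent K (fun i : Fin d => (T ^ (i : ℕ)) v) ∧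
      (T ^ d) v ∈ Submodule.span K (Set.range fun i : Fin d => (T ^ (i : ℕ)) v) := by
  classical
  have hsucc : ∀ d : ℕ, LinearIndependent K (fun i : Fin d => (T ^ (i : ℕ)) v) →
      (T ^ d) v ∉ Submodule.span K (Set.range fun i : Fin d => (T ^ (i : ℕ)) v) →
      LinearIndependent K (fun i : Fin (d + 1) => (T ^ (i : ℕ)) v) := fun d h h' =>
    linearIndependent_finSucc'.mpr ⟨h, h'⟩
  by_contra! H
  have hall : ∀ d : ℕ, LinearIndependent K (fun i : Fin d => (T ^ (i : ℕ)) v) := by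
    intro d
    induction d with
    | zero => exact linearIndependent_empty_type
    | succ d ih => exact hsucc d ih (H d ih)
  have := (hall (Module.finrank K V + 1)).fintype_card_le_finrank
  simp at this

/-! ### Matrices over F_2 -/

theorem Module.End.isNilCleanElem_zmod_two (n : ℕ) : ∀ {V : Type} [AddCommGroup V]
    [Module (ZMod 2) V] [FiniteDimensional (ZMod 2) V] (T : Module.End (ZMod 2) V),
    Module.finrank (ZMod 2) V = n → IsNilCleanElem T := by
  induction n using Nat.strong_induction_on with
  | _ n ih =>
  intro V _ _ _ T hn
  rcases subsingleton_or_nontrivial V with hV | hV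
  · exact ⟨0, .zero, 1, LinearMap.ext fun x => Subsingleton.elim _ _⟩
  obtain ⟨v, hv⟩ := exists_ne (0 : V)
  obtain ⟨d, hli, hd⟩ := exists_cyclic_submodule T v
  set W := Submodule.span (ZMod 2) (Set.range fun i : Fin d => (T ^ (i : ℕ)) v) with hWdef
  have hpow : ∀ j ≤ d, (T ^ j) v ∈ W := by
    intro j hj
    rcases hj.lt_or_eq with h | rfl
    · exact Submodule.subset_span ⟨⟨j, h⟩, rfl⟩
    · exact hd
  have hW : ∀ w ∈ W, T w ∈ W := by
    suffices W ≤ W.comap T from fun w hw => this hw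
    refine Submodule.span_le.mpr ?_
    rintro _ ⟨i, rfl⟩
    have := hpow (i + 1) i.2
    rwa [pow_succ', Module.End.mul_apply] at this
  have hvW : v ∈ W := by simpa using hpow 0 (Nat.zero_le _)
  have hWpos : 0 < Module.finrank (ZMod 2) W :=
    Module.finrank_pos_iff_exists_ne_zero.mpr ⟨⟨v, hvW⟩, by simpa using hv⟩
  refine IsNilCleanElem.of_restrict_of_mapQ T W hW ?_ ?_
  · let t := Module.Basis.span hli
    refine isNilCleanElem_of_cyclic (T.restrict hW) ⟨v, hvW⟩ t fun i => ?_
    apply Subtype.ext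
    rw [Module.Basis.span_apply, Module.End.pow_restrict]
    rfl
  · have := W.finrank_quotient_add_finrank
    exact ih _ (by lia) _ rfl

theorem Matrix.isNilCleanElem_zmod_two {n : ℕ} (A : Matrix (Fin n) (Fin n) (ZMod 2)) :
    IsNilCleanElem A := by
  have := (Module.End.isNilCleanElem_zmod_two _ (Matrix.toLinAlgEquiv' A) rfl).map
    (Matrix.toLinAlgEquiv'.symm : _ ≃ₐ[ZMod 2] Matrix (Fin n) (Fin n) (ZMod 2)).toRingEquiv.toRingHom
  simpa using this

/-! ### From F_2 to Boolean rings -/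

/-- In a Boolean ring, every finite family is the image of the coordinate functions under some
ring homomorphism defined on the functions on the cube. -/
theorem exists_ringHom_of_boolean {ι R : Type*} [Fintype ι] [CommRing R] [CharP R 2]
    (hR : IsBooleanRing R) (x : ι → R) :
    ∃ φ : ((ι → ZMod 2) → ZMod 2) →+* R, ∀ i, φ (fun a => a i) = x i := by
  classical
  let c : ZMod 2 →+* R := ZMod.castHom dvd_rfl R
  let y : ι → ZMod 2 → R := fun i b => if b = 1 then x i else 1 - x i
  -- The atoms of the Boolean algebra generated by the `x i`: complete orthogonal idempotents
  -- indexed by the cube.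
  let χ : (ι → ZMod 2) → R := fun a => ∏ i, y i (a i)
  have hxx : ∀ i, x i * x i = x i := fun i => hR (x i)
  have hy : ∀ i b, x i * y i b = c b * y i b := by
    intro i b
    rcases ZMod.two_eq_zero_or_eq_one b with rfl | rfl
    · simp [y, mul_sub, hxx]
    · simp [y, hxx]
  have hyy : ∀ i b b', b ≠ b' → y i b * y i b' = 0 := by
    intro i b b' hb
    rcases ZMod.two_eq_zero_or_eq_one b with rfl | rfl <;>
      rcases ZMod.two_eq_zero_or_eq_one b' with rfl | rfl <;>
      simp_all [y, mul_sub, sub_mul]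
  have hsum : ∑ a, χ a = 1 := by
    have := Finset.prod_univ_sum (fun _ : ι => (Finset.univ : Finset (ZMod 2))) y
    rw [Fintype.piFinset_univ] at this
    rw [← this]
    refine Finset.prod_eq_one fun i _ => ?_
    have : (Finset.univ : Finset (ZMod 2)) = {0, 1} := rfl
    simp [this, y]
  have hχ : ∀ i a, x i * χ a = c (a i) * χ a := by
    intro i a
    simp only [χ]
    rw [← Finset.mul_prod_erase _ _ (Finset.mem_univ i), ← mul_assoc, hy, mul_assoc]
  have hχχ : ∀ a b, χ a * χ b = if a = b then χ a else 0 := by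
    intro a b
    split_ifs with h
    · rw [← h]; exact hR _
    · obtain ⟨i, hi⟩ := Function.ne_iff.mp h
      simp only [χ]
      rw [← Finset.prod_mul_distrib]
      exact Finset.prod_eq_zero (Finset.mem_univ i) (hyy i _ _ hi)
  let φ : ((ι → ZMod 2) → ZMod 2) →+* R :=
    { toFun := fun g => ∑ a, c (g a) * χ a
      map_one' := by simp [hsum]
      map_zero' := by simp
      map_add' := fun g h => by simp [add_mul, Finset.sum_add_distrib]
      map_mul' := fun g h => by
        rw [Finset.sum_mul_sum]
        refine Finset.sum_congr rfl fun a _ => ?_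
        have : ∀ b, c (g a) * χ a * (c (h b) * χ b) =
            if a = b then c (g a) * c (h b) * χ a else 0 := fun b => by
          rw [mul_mul_mul_comm, hχχ, mul_ite, mul_zero]
        simp [this] }
  refine ⟨φ, fun i => ?_⟩
  change ∑ a, c (a i) * χ a = x i
  rw [← mul_one (x i), ← hsum, Finset.mul_sum]
  exact Finset.sum_congr rfl fun a _ => (hχ i a).symm

theorem Matrix.isNilCleanElem_of_commRing {R : Type*} [CommRing R] [CharP R 2]
    (hR : IsBooleanRing R) {n : ℕ} (A : Matrix (Fin n) (Fin n) R) : IsNilCleanElem A := by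
  obtain ⟨φ, hφ⟩ := exists_ringHom_of_boolean hR (fun p : Fin n × Fin n => A p.1 p.2)
  let S := (Fin n × Fin n → ZMod 2) → ZMod 2
  let G : Matrix (Fin n) (Fin n) S := Matrix.of fun i j a => a (i, j)
  have hG : IsNilCleanElem G := by
    choose e he k hk using fun a : Fin n × Fin n → ZMod 2 =>
      Matrix.isNilCleanElem_zmod_two (Matrix.of fun i j => a (i, j))
    let ev (a : Fin n × Fin n → ZMod 2) : Matrix (Fin n) (Fin n) S →+*
      Matrix (Fin n) (Fin n) (ZMod 2) := (Pi.evalRingHom (fun _ => ZMod 2) a).mapMatrix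
    have hev : ∀ X Y : Matrix (Fin n) (Fin n) S, (∀ a, ev a X = ev a Y) → X = Y := by
      intro X Y h
      ext i j a
      exact congrFun (congrFun (h a) i) j
    let E : Matrix (Fin n) (Fin n) S := Matrix.of fun i j a => e a i j
    have hE : ∀ a, ev a E = e a := fun a => rfl
    have hGa : ∀ a, ev a G = Matrix.of fun i j => a (i, j) := fun a => rfl
    -- The cube is finite, so the sum bounds all nilpotency indices at once.
    refine ⟨E, hev _ _ fun a => ?_, ∑ a, k a, hev _ _ fun a => ?_⟩
    · rw [map_mul, hE]
      exact he a
    · rw [map_pow, map_sub, hE, hGa, map_zero]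
      exact pow_eq_zero_of_le (Finset.single_le_sum (fun _ _ => Nat.zero_le _)
        (Finset.mem_univ a)) (hk a)
  have := hG.map φ.mapMatrix
  convert this
  ext i j
  exact (hφ (i, j)).symm

theorem IsBooleanRing.isNilCleanElem_matrix {R : Type*} [Ring R] (hR : IsBooleanRing R) {n : ℕ}
    (A : Matrix (Fin n) (Fin n) R) : IsNilCleanElem A := by
  rcases subsingleton_or_nontrivial R with h | h
  · exact ⟨0, .zero, 1, Subsingleton.elim _ _⟩
  let _ : BooleanRing R := BooleanRing.mk hR
  have : CharP R 2 := CharTwo.of_one_ne_zero_of_two_eq_zero one_ne_zero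
    (by rw [← one_add_one_eq_two]; exact BooleanRing.add_self (1 : R))
  exact Matrix.isNilCleanElem_of_commRing hR A

/-! ### Nil-clean matrices over division rings -/

section Division
variable {D : Type*} [DivisionRing D] {n : ℕ}
open Matrix

theorem Matrix.vecMul_pow_eq_smul {N : Matrix (Fin n) (Fin n) D} {x : Fin n → D} {β : D}
    (h : x ᵥ* N = β • x) (k : ℕ) : x ᵥ* N ^ k = β ^ k • x := by
  induction k with
  | zero => simp
  | succ k ih => rw [pow_succ, ← vecMul_vecMul, ih, smul_vecMul, h, smul_smul, pow_succ]

theorem Matrix.eq_zero_of_vecMul_eq_smul {N : Matrix (Fin n) (Fin n) D} (hN : IsNilpotent N)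
    {x : Fin n → D} (hx : x ≠ 0) {β : D} (h : x ᵥ* N = β • x) : β = 0 := by
  obtain ⟨k, hk⟩ := hN
  have := Matrix.vecMul_pow_eq_smul h k
  rw [hk, vecMul_zero, eq_comm, smul_eq_zero] at this
  exact eq_zero_of_pow_eq_zero (this.resolve_right hx)

/-- A nilpotent matrix squares to zero on a vector which spans with its image an invariant
subspace. -/
theorem Matrix.vecMul_vecMul_eq_zero {N : Matrix (Fin n) (Fin n) D} (hN : IsNilpotent N)
    {x : Fin n → D} (hx : x ≠ 0) {α β : D}
    (h : (x ᵥ* N) ᵥ* N = α • x + β • (x ᵥ* N)) : (x ᵥ* N) ᵥ* N = 0 := by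
  classical
  have hex : ∃ k, x ᵥ* N ^ k = 0 := by
    obtain ⟨k, hk⟩ := hN
    exact ⟨k, by rw [hk, vecMul_zero]⟩
  -- Apply the last power of `N` that does not kill `x` to the relation: only the `α` term survives.
  have hα : α = 0 := by
    obtain ⟨m, hm⟩ : ∃ m, Nat.find hex = m + 1 := by
      refine Nat.exists_eq_succ_of_ne_zero fun h0 => hx ?_
      simpa [h0] using Nat.find_spec hex
    have h1 : x ᵥ* N ^ (m + 1) = 0 := hm ▸ Nat.find_spec hex
    have h0 : x ᵥ* N ^ m ≠ 0 := Nat.find_min hex (by lia)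
    have := congrArg (· ᵥ* N ^ m) h
    simp only [add_vecMul, smul_vecMul, vecMul_vecMul] at this
    rw [← pow_succ', h1, mul_assoc, ← pow_succ', ← pow_succ', pow_succ, ← vecMul_vecMul, h1,
      zero_vecMul, smul_zero, add_zero, eq_comm, smul_eq_zero] at this
    exact this.resolve_right h0
  rw [hα, zero_smul, zero_add] at h
  by_cases hw : x ᵥ* N = 0
  · rw [hw, zero_vecMul]
  · rw [h, Matrix.eq_zero_of_vecMul_eq_smul hN hw h, zero_smul]

/-- For a ≠ 0 the idempotent has rank one: a fixed row vector vanishing at `i₀` would be an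
eigenvector of `N` for -1. So `N` preserves the span of `e` and the fixed vector `v`, and nilpotency
there determines `a`. -/
theorem Matrix.eq_zero_or_eq_one_of_single_isNilCleanElem (i₀ : Fin n) (a : D)
    (h : IsNilCleanElem (Matrix.single i₀ i₀ a)) : a = 0 ∨ a = 1 := by
  obtain ⟨E, hE, hN⟩ := h
  set N := Matrix.single i₀ i₀ a - E with hNdef
  by_cases ha : a = 0
  · exact Or.inl ha
  right
  let e : Fin n → D := Pi.single i₀ 1
  have he0 : e ≠ 0 := by simp [e]
  have hA : ∀ x : Fin n → D, x ᵥ* Matrix.single i₀ i₀ a = (x i₀ * a) • e := by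
    intro x
    ext j
    by_cases hj : j = i₀
    · subst hj; simp [e, vecMul, dotProduct, Matrix.single_apply]
    · simp [e, vecMul, dotProduct, hj, Ne.symm hj]
  have hNx : ∀ x : Fin n → D, x ᵥ* N = (x i₀ * a) • e - x ᵥ* E := fun x => by
    rw [hNdef, vecMul_sub, hA]
  have hfix : ∀ x : Fin n → D, x ᵥ* E = x → x i₀ = 0 → x = 0 := by
    intro x hx hx0
    by_contra hne
    have : x ᵥ* N = (-1 : D) • x := by rw [hNx, hx, hx0]; simp
    exact one_ne_zero (neg_eq_zero.mp (Matrix.eq_zero_of_vecMul_eq_smul hN hne this))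
  have hEx : ∀ x : Fin n → D, (x ᵥ* E) ᵥ* E = x ᵥ* E := fun x => by
    rw [vecMul_vecMul, hE.eq]
  -- a vector `v` fixed by `E` with coordinate one at `i₀`
  obtain ⟨v, hv, hv1⟩ : ∃ v : Fin n → D, v ᵥ* E = v ∧ v i₀ = 1 := by
    by_cases hz : (e ᵥ* E) = 0
    · have : e ᵥ* N = a • e := by rw [hNx, hz]; simp [e]
      exact absurd (Matrix.eq_zero_of_vecMul_eq_smul hN he0 this) ha
    · have h0 : (e ᵥ* E) i₀ ≠ 0 := fun h => hz (hfix _ (hEx e) h)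
      exact ⟨((e ᵥ* E) i₀)⁻¹ • (e ᵥ* E), by rw [smul_vecMul, hEx], by simp [h0]⟩
  have hE1 : ∀ x : Fin n → D, x ᵥ* E = ((x ᵥ* E) i₀) • v := by
    intro x
    refine sub_eq_zero.mp (hfix _ ?_ ?_)
    · rw [sub_vecMul, hEx, smul_vecMul, hv]
    · simp [hv1]
  have hv0 : v ≠ 0 := by rintro rfl; simp at hv1
  set u := (e ᵥ* E) i₀
  have heN : e ᵥ* N = a • e - u • v := by rw [hNx, hE1 e]; simp [e, u]
  have hvN : v ᵥ* N = a • e - v := by rw [hNx, hv, hv1, one_mul]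
  have hvNN : (v ᵥ* N) ᵥ* N = (a * a - a) • e + (1 - a * u) • v := by
    rw [hvN, sub_vecMul, smul_vecMul, heN, hvN, smul_sub, smul_smul, smul_smul, sub_smul, sub_smul,
      one_smul]
    abel
  have hzero : (v ᵥ* N) ᵥ* N = 0 := by
    refine Matrix.vecMul_vecMul_eq_zero hN hv0 (α := a - 1 + (1 - a * u)) (β := a - 1) ?_
    rw [hvNN, hvN, smul_sub, smul_smul, sub_mul, one_mul, add_smul]
    abel
  rw [hvNN] at hzero
  by_cases hpar : ∃ j, j ≠ i₀ ∧ v j ≠ 0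
  · obtain ⟨j, hj, hvj⟩ := hpar
    have h1 := congrFun hzero j
    simp [e, hj, hvj] at h1
    have h2 := congrFun hzero i₀
    simp [e, h1] at h2
    have : a * (a - 1) = 0 := by rw [mul_sub, mul_one]; exact h2
    exact sub_eq_zero.mp ((mul_eq_zero.mp this).resolve_left ha)
  · push Not at hpar
    have hve : v = e := by
      ext j
      by_cases hj : j = i₀
      · subst hj; simp [e, hv1]
      · simp [e, hj, hpar j hj]
    have : v ᵥ* N = (a - 1) • v := by rw [hvN, hve, sub_smul, one_smul]
    exact sub_eq_zero.mp (Matrix.eq_zero_of_vecMul_eq_smul hN hv0 this)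

theorem IsWeaklyNilCleanElem.isNilCleanElem_or_neg {R : Type*} [Ring R] {a : R}
    (h : IsWeaklyNilCleanElem a) : IsNilCleanElem a ∨ IsNilCleanElem (-a) := by
  obtain ⟨b, e, hb, he, rfl | rfl⟩ := h
  · exact Or.inl ⟨e, he, by simpa using hb⟩
  · exact Or.inr ⟨e, he, by simpa using hb.neg⟩

end Division

/-- The rank of the idempotent equals its trace, hence is 0 mod 3, yet it is at most 2. So the
idempotent is 0, while the matrix has the nonzero eigenvalue `c`. -/
theorem Matrix.not_isNilCleanElem_diagonal {K : Type*} [Field K] (h3 : (3 : K) = 0) {n : ℕ}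
    {i j : Fin n} (hij : i ≠ j) {c : K} (hc : c ≠ 0) :
    ¬ IsNilCleanElem (Matrix.single i i c - Matrix.single j j c) := by
  classical
  rintro ⟨E, hE, hN⟩
  set A := Matrix.single i i c - Matrix.single j j c with hA
  have hAx : ∀ x : Fin n → K, x i = 0 → x j = 0 → A.mulVec x = 0 := by
    intro x hi hj
    rw [hA, Matrix.sub_mulVec]
    ext l
    simp [Matrix.single_mulVec, hi, hj]
  let f := Matrix.toLin' E
  have hf : IsIdempotentElem f := hE.map (Matrix.toLinAlgEquiv' : _ ≃ₐ[K] _)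
  have htr : LinearMap.trace K _ f = Module.finrank K (LinearMap.range f) :=
    (LinearMap.IsIdempotentElem.isProj_range f hf).trace
  -- the trace of `E` vanishes
  have htr0 : LinearMap.trace K _ f = 0 := by
    have h1 := (Matrix.isNilpotent_trace_of_isNilpotent hN).eq_zero
    rw [Matrix.trace_sub, hA, Matrix.trace_sub, Matrix.trace_single_eq_same,
      Matrix.trace_single_eq_same, sub_self, zero_sub, neg_eq_zero] at h1
    rw [Matrix.trace_toLin'_eq, h1]
  -- the rank of `E` is at most two
  let g : LinearMap.range f →ₗ[K] (Fin 2 → K) :=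
    LinearMap.pi ![LinearMap.proj i ∘ₗ Submodule.subtype _, LinearMap.proj j ∘ₗ Submodule.subtype _]
  have hg : Function.Injective g := by
    rw [← LinearMap.ker_eq_bot, LinearMap.ker_eq_bot']
    rintro ⟨x, hx⟩ hgx
    have hxi : x i = 0 := by simpa [g] using congrFun hgx 0
    have hxj : x j = 0 := by simpa [g] using congrFun hgx 1
    have hfx : E.mulVec x = x := by
      obtain ⟨y, rfl⟩ := hx
      exact LinearMap.congr_fun hf y
    have hNx : (A - E).mulVec x = -x := by rw [Matrix.sub_mulVec, hAx x hxi hxj, hfx, zero_sub]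
    obtain ⟨k, hk⟩ := hN
    have hpow : ∀ k : ℕ, ((A - E) ^ k).mulVec x = (-1 : K) ^ k • x := by
      intro k
      induction k with
      | zero => simp
      | succ k ih =>
        rw [pow_succ, ← Matrix.mulVec_mulVec, hNx, Matrix.mulVec_neg, ih, pow_succ]
        simp
    have := hpow k
    rw [hk, Matrix.zero_mulVec, eq_comm, smul_eq_zero] at this
    exact Subtype.ext (this.resolve_left (pow_ne_zero _ (neg_ne_zero.mpr one_ne_zero)))
  have hrank : Module.finrank K (LinearMap.range f) ≤ 2 := by
    simpa using LinearMap.finrank_le_finrank_of_injective hg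
  have hrank0 : Module.finrank K (LinearMap.range f) = 0 := by
    rw [htr0] at htr
    have h2 : (2 : K) ≠ 0 := fun h => one_ne_zero (α := K) (by linear_combination h3 - h)
    interval_cases Module.finrank K (LinearMap.range f)
    · rfl
    · simp at htr
    · exact absurd htr.symm (by exact_mod_cast h2)
  have hf0 : f = 0 := LinearMap.range_eq_bot.mp (Submodule.finrank_eq_zero.mp hrank0)
  have hE0 : E = 0 := by
    have := Matrix.toLin'.map_eq_zero_iff.mp hf0
    exact this
  rw [hE0, sub_zero] at hN
  have hv : Matrix.vecMul (Pi.single i 1) A = c • Pi.single i 1 := by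
    rw [hA, Matrix.vecMul_sub]
    ext l
    by_cases hl : l = i
    · subst hl; simp [hij.symm]
    · simp [hij.symm, hl, Ne.symm hl]
  exact hc (Matrix.eq_zero_of_vecMul_eq_smul hN (by simp) hv)

theorem eq_zero_or_eq_one_of_isWeaklyNilCleanRing_matrix {D : Type*} [DivisionRing D] {n : ℕ}
    (hn : 2 ≤ n) (h : IsWeaklyNilCleanRing (Matrix (Fin n) (Fin n) D)) (a : D) :
    a = 0 ∨ a = 1 := by
  let i : Fin n := ⟨0, by lia⟩
  let j : Fin n := ⟨1, by lia⟩
  have hij : i ≠ j := by simp [i, j]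
  have h3 : ∀ b : D, b = 0 ∨ b = 1 ∨ b = -1 := by
    intro b
    rcases (h (Matrix.single i i b)).isNilCleanElem_or_neg with hb | hb
    · rcases Matrix.eq_zero_or_eq_one_of_single_isNilCleanElem i b hb with h | h <;> simp [h]
    · rw [Matrix.single_neg] at hb
      rcases Matrix.eq_zero_or_eq_one_of_single_isNilCleanElem i (-b) hb with h | h
      · simp [neg_eq_zero.mp h]
      · simp [← h]
  by_cases h2 : (1 : D) = -1
  · simpa [← h2] using h3 a
  exfalso
  let _ : Field D := { ‹DivisionRing D› with
    mul_comm := fun x y => by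
      rcases h3 x with rfl | rfl | rfl <;> rcases h3 y with rfl | rfl | rfl <;> simp }
  have h30 : (3 : D) = 0 := by
    rcases h3 2 with h | h | h
    · exact absurd (by linear_combination h) h2
    · exact absurd (by linear_combination h : (1 : D) = 0) one_ne_zero
    · linear_combination h
  rcases (h (Matrix.single i i 1 - Matrix.single j j 1)).isNilCleanElem_or_neg with hb | hb
  · exact Matrix.not_isNilCleanElem_diagonal h30 hij one_ne_zero hb
  · rw [neg_sub] at hb
    exact Matrix.not_isNilCleanElem_diagonal h30 hij.symm one_ne_zero hb

/-! ### Division ring quotients of strongly regular rings -/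

theorem IsWeaklyNilCleanRing.of_surjective {R S : Type*} [Ring R] [Ring S] (f : R →+* S)
    (hf : Function.Surjective f) (h : IsWeaklyNilCleanRing R) : IsWeaklyNilCleanRing S := by
  intro s
  obtain ⟨a, rfl⟩ := hf s
  obtain ⟨b, e, hb, he, rfl | rfl⟩ := h a
  · exact ⟨f b, f e, hb.map f, he.map f, Or.inl (map_add f b e)⟩
  · exact ⟨f b, f e, hb.map f, he.map f, Or.inr (map_sub f b e)⟩

theorem IsStronglyRegularRing.isTwoSided {R : Type*} [Ring R] (hR : IsStronglyRegularRing R)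
    (I : Ideal R) : I.IsTwoSided := by
  refine ⟨fun {a} r ha => ?_⟩
  obtain ⟨x, hx⟩ := hR.2 a
  have hc := Subring.mem_center_iff.mp (hR.1 (x * a) (by
    unfold IsIdempotentElem; rw [mul_assoc, ← mul_assoc a, ← hx])) r
  -- The idempotent `x * a` is central, so it moves past `r`.
  have : a * r = a * r * x * a := by
    conv_lhs => rw [hx, mul_assoc a, mul_assoc a, ← hc]
    simp only [mul_assoc]
  rw [this]
  exact I.mul_mem_left _ ha

/-- A nonzero element of a strongly regular ring survives in some quotient which is a division
ring. -/
theorem IsStronglyRegularRing.exists_maximal {R : Type*} [Ring R] (hR : IsStronglyRegularRing R)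
    {b : R} (hb : b ≠ 0) : ∃ M : Ideal R, M.IsMaximal ∧ b ∉ M := by
  obtain ⟨y, hy⟩ := hR.2 b
  -- A maximal left ideal containing `1 - y * b` cannot contain `b`; this one is proper since `y *
  -- b` is a nonzero idempotent.
  have hlt : Ideal.span {1 - y * b} ≠ ⊤ := by
    rw [Ne, Ideal.eq_top_iff_one, Ideal.mem_span_singleton']
    rintro ⟨r, hr⟩
    have hI : (1 - y * b) * (y * b) = 0 := by
      rw [sub_mul, one_mul, mul_assoc, ← mul_assoc b, ← hy, sub_self]
    have : y * b = 0 := by rw [← one_mul (y * b), ← hr, mul_assoc, hI, mul_zero]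
    exact hb (by rw [hy, mul_assoc, this, mul_zero])
  obtain ⟨M, hM, hle⟩ := Ideal.exists_le_maximal _ hlt
  refine ⟨M, hM, fun hbM => hM.ne_top (M.eq_top_iff_one.mpr ?_)⟩
  have := M.add_mem (hle (Ideal.mem_span_singleton_self _)) (M.mul_mem_left y hbM)
  rwa [sub_add_cancel] at this

theorem Ideal.Quotient.isUnit_or_eq_zero {R : Type*} [Ring R] (M : Ideal R) [M.IsTwoSided]
    (hM : M.IsMaximal) (a : R ⧸ M) : IsUnit a ∨ a = 0 := by
  have hinv : ∀ a : R ⧸ M, a ≠ 0 → ∃ b, b * a = 1 := by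
    intro a ha
    obtain ⟨r, rfl⟩ := Ideal.Quotient.mk_surjective a
    have hr : r ∉ M := fun h => ha (Ideal.Quotient.eq_zero_iff_mem.mpr h)
    obtain ⟨s, m, hm, hs⟩ := hM.exists_inv hr
    refine ⟨Ideal.Quotient.mk M s, ?_⟩
    rw [← map_mul, ← map_one (Ideal.Quotient.mk M), ← hs, map_add,
      Ideal.Quotient.eq_zero_iff_mem.mpr hm, add_zero]
  have : Nontrivial (R ⧸ M) := Ideal.Quotient.nontrivial_iff.mpr hM.ne_top
  by_cases ha : a = 0
  · exact Or.inr ha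
  obtain ⟨b, hb⟩ := hinv a ha
  obtain ⟨c, hc⟩ := hinv b (by rintro rfl; simp at hb)
  have : c = a := by rw [← mul_one c, ← hb, ← mul_assoc, hc, one_mul]
  exact Or.inl ⟨⟨a, b, this ▸ hc, hb⟩, rfl⟩

theorem corollary4p9 {R : Type*} [Ring R] (hR : IsStronglyRegularRing R) (n : ℕ) (hn : 2 ≤ n) :
    IsWeaklyNilCleanRing (Matrix (Fin n) (Fin n) R) ↔ IsBooleanRing R := by
  refine ⟨fun h a => ?_, fun h A => (h.isNilCleanElem_matrix A).isWeaklyNilCleanElem⟩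
  by_contra ha
  obtain ⟨M, hM, hbM⟩ := hR.exists_maximal (sub_ne_zero.mpr ha)
  have := hR.isTwoSided M
  have : Nontrivial (R ⧸ M) := Ideal.Quotient.nontrivial_iff.mpr hM.ne_top
  let _ := DivisionRing.ofIsUnitOrEqZero (Ideal.Quotient.isUnit_or_eq_zero M hM)
  have hD : IsWeaklyNilCleanRing (Matrix (Fin n) (Fin n) (R ⧸ M)) :=
    h.of_surjective (Ideal.Quotient.mk M).mapMatrix
      fun B => ⟨B.map (Function.surjInv Ideal.Quotient.mk_surjective), by
        ext i j
        exact Function.surjInv_eq Ideal.Quotient.mk_surjective _⟩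
  apply hbM
  rw [← Ideal.Quotient.eq_zero_iff_mem, map_sub, map_mul]
  rcases eq_zero_or_eq_one_of_isWeaklyNilCleanRing_matrix hn hD (Ideal.Quotient.mk M a) with h | h
    <;> simp [h]
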